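/- **Meeting Time Lemma.** Let $V$ be a finite set with at least two elements, and let $q(x,y)\ge 0$ ($x,y\in V$, $x\ne y$) be the transition rates of an irreducible continuous-time Markov chain on $V$; that is, for every $A\subset V$ with $A\neq\emptyset\neq V\setminus A$ there are $a\in A$, $b\in V\setminus A$ with $q(a,b)\ne 0$. Let $Q$ be the matrix acting on functions by $(Qf)(x)=\sum_{y\ne x}q(x,y)(f(x)-f(y))$. Let $\mathbb{D}=\mathbb{D}([0,\infty),V)$ be the set of càdlàg paths (those constant on each interval $[t_{i-1},t_i)$ for some $0=t_0<t_1<t_2<\cdots\nearrow\infty$), with the $\sigma$-field generated by the coordinates $X_t(\omega)=\omega(t)$, and let $(P_x)_{x\in V}$ be the laws of the chain: probability measures on $\mathbb{D}$ with $P_x(X_0=x)=1$ and, for all $s,t\ge 0$ and $y\in V$, $P_x(X_{s+t}=y\mid \sigma(X_r:r\le s))=e^{-tQ}(X_s,y)$ almost surely. For a probability distribution $\mu$ on $V$ put $P_\mu=\sum_x\mu(x)P_x$, with expectation $E_\mu$, and let $H_v=\inf\{t\ge 0: X_t=v\}$. Let $\pi$ be the stationary distribution, and assume that the chain is reversible: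 $\pi(x)q(x,y)=\pi(y)q(y,x)$ for all $x\neq y$. A quasistationary distribution for $V\setminus\{v\}$ is a probability distribution $\mu$ on $V$ such that, for all $t\ge0$ and $b\in V$, $P_\mu(H_v>t)>0$ and $\mu(b)=P_\mu(X_t=b\mid H_v>t)$. Then there exist a state $v\in V$ and a quasistationary distribution $\mathsf{q}_v$ for $V\setminus\{v\}$, with $0<E_{\mathsf{q}_v}[H_v]<\infty$, such that for every deterministic path $h\in\mathbb{D}$ and every $t\ge 0$, $$P_\pi\bigl(X_s\neq h_s\text{ for all }0\le s\le t\bigr)\;\le\;P_{\mathsf{q}_v}(H_v>t)\;=\;\exp\!\left(-\frac{t}{E_{\mathsf{q}_v}[H_v]}\right).$$ -/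

import Mathlib

open MeasureTheory Filter
open scoped NNReal ENNReal

noncomputable section

namespace MeetingTime

/-- A function `ω : [0, ∞) → V` into a finite set is càdlàg if there are times
`0 = τ 0 < τ 1 < τ 2 < ⋯ ↗ ∞` such that `ω` is constant on every `[τ i, τ (i + 1))`. -/
def IsCadlag {V : Type*} (ω : ℝ≥0 → V) : Prop :=
  ∃ τ : ℕ → ℝ≥0, τ 0 = 0 ∧ StrictMono τ ∧ Tendsto τ atTop atTop ∧
    ∀ i, ∀ s ∈ Set.Ico (τ i) (τ (i + 1)), ω s = ω (τ i)

/-- The path space `𝔻([0, ∞), V)`. -/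
structure PathSpace (V : Type*) where
  toFun : ℝ≥0 → V
  isCadlag : IsCadlag toFun

/-- The coordinate process: `X t ω = ω(t)`. -/
def X {V : Type*} (t : ℝ≥0) (ω : PathSpace V) : V := ω.toFun t

/-- The σ-algebra on the path space generated by all coordinates
(`V` carries the σ-algebra of all subsets). -/
instance instMeasurableSpacePathSpace (V : Type*) : MeasurableSpace (PathSpace V) :=
  ⨆ t : ℝ≥0, MeasurableSpace.comap (X t) ⊤

/-- The σ-algebra `ℱ_s = σ(X_r : r ≤ s)`. -/
@[reducible] def past (V : Type*) (s : ℝ≥0) : MeasurableSpace (PathSpace V) :=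
  ⨆ r ∈ Set.Iic s, MeasurableSpace.comap (X r) ⊤

/-- The operator `(Q f)(x) = ∑_{y ≠ x} q(x, y) (f(x) - f(y))` as a matrix. The diagonal values of
the rate function `q` play no role. With this sign the transition matrices are `e^{-tQ}`. -/
def generator {V : Type*} [Fintype V] [DecidableEq V] (q : V → V → ℝ) : Matrix V V ℝ :=
  Matrix.of fun x y => if x = y then ∑ z ∈ Finset.univ.erase x, q x z else -q x y

/-- `P = (P_x)_{x ∈ V}` is the family of path laws of the continuous-time Markov chain with
transition rates `q`: `P_x(X_0 = x) = 1` and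
`P_x(X_{s+t} = y | ℱ_s) = e^{-tQ}(X_s, y)` almost surely. -/
structure IsChainLaw {V : Type*} [Fintype V] [DecidableEq V] (q : V → V → ℝ)
    (P : V → Measure (PathSpace V)) : Prop where
  isProbabilityMeasure : ∀ x, IsProbabilityMeasure (P x)
  start : ∀ x, P x {ω | X 0 ω = x} = 1
  markov : ∀ (x : V) (s t : ℝ≥0) (y : V),
    (P x)[Set.indicator {ω | X (s + t) ω = y} (fun _ => (1 : ℝ)) | past V s]
      =ᵐ[P x] fun ω => NormedSpace.exp ((-(t : ℝ)) • generator q) (X s ω) y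

/-- `P_μ = ∑_x μ(x) P_x`, the law of the chain with initial distribution `μ`. -/
def lawFrom {V : Type*} [Fintype V] (P : V → Measure (PathSpace V)) (μ : V → ℝ) :
    Measure (PathSpace V) :=
  ∑ x, ENNReal.ofReal (μ x) • P x

/-- Irreducibility of the rates: every nonempty proper subset can be left. -/
def IsIrreducible {V : Type*} (q : V → V → ℝ) : Prop :=
  ∀ A : Set V, A.Nonempty → Aᶜ.Nonempty → ∃ a ∈ A, ∃ b ∈ Aᶜ, q a b ≠ 0

/-- `π` is a stationary distribution: `P_π(X_t = x) = π(x)` for all `t` and `x`. -/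
def IsStationary {V : Type*} [Fintype V] (P : V → Measure (PathSpace V)) (π : V → ℝ) : Prop :=
  π ∈ stdSimplex ℝ V ∧ ∀ (t : ℝ≥0) (x : V), (lawFrom P π).real {ω | X t ω = x} = π x

/-- Reversibility (detailed balance) of the rates with respect to `π`. -/
def IsReversible {V : Type*} (q : V → V → ℝ) (π : V → ℝ) : Prop :=
  ∀ x y, x ≠ y → π x * q x y = π y * q y x

/-- The hitting time `H_v = inf {t ≥ 0 : X_t = v}`, equal to `∞` if `v` is never visited. -/
def hitTime {V : Type*} (v : V) (ω : PathSpace V) : ℝ≥0∞ :=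
  ⨅ (t : ℝ≥0) (_ : X t ω = v), (t : ℝ≥0∞)

/-- `E_μ[H_v]`, as an extended nonnegative number. -/
def expHitTime {V : Type*} [Fintype V] (P : V → Measure (PathSpace V)) (μ : V → ℝ) (v : V) :
    ℝ≥0∞ :=
  ∫⁻ ω, hitTime v ω ∂(lawFrom P μ)

/-- `μ` is a quasistationary distribution for `V \ {v}`: a probability distribution on `V` with
`μ(b) = P_μ(X_t = b | H_v > t)` for all `t ≥ 0` and all `b`. -/
def IsQuasistationary {V : Type*} [Fintype V] (P : V → Measure (PathSpace V)) (v : V)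
    (μ : V → ℝ) : Prop :=
  μ ∈ stdSimplex ℝ V ∧ ∀ (t : ℝ≥0), 0 < lawFrom P μ {ω | (t : ℝ≥0∞) < hitTime v ω} ∧
    ∀ b : V, μ b =
      (ProbabilityTheory.cond (lawFrom P μ) {ω | (t : ℝ≥0∞) < hitTime v ω}).real {ω | X t ω = b}

end MeetingTime

end

/-!
The proof bounds both sides by `exp (-l t)`, where `l` is the smallest, over all states `v`, of the
principal Dirichlet eigenvalues `l v` of the generator `Q` on `V \ {v}`, and `v` is a state
attaining the minimum. Everything takes place in `L²(π)`, where `Q` is self-adjoint.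

*Avoiding a path.* The event of avoiding `h` on `[0, t]` is contained in the event of avoiding it at
the times `0, d, 2 d, …, n d = t`. By the Markov property, the law of the chain killed on this grid
is obtained by alternately applying `e^{-dQ}` and setting to zero the mass at the current position
of `h`. Before each application of `e^{-dQ}` the density vanishes at some state `w`, so that its
Rayleigh quotient is at least `l w ≥ l`, and `e^{-dQ} = 1 - d Q + o(d)` contracts its squared norm
by `exp (-2 l d + o(d))` (`exists_densityNormSq_le`). Multiplying these bounds, applying the
Cauchy–Schwarz inequality and letting `d → 0` gives `exp (-l t)` (`real_avoid_le`).

*The quasistationary distribution.* The Rayleigh quotient on functions vanishing at `v` has a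
nonnegative minimiser `f` (`exists_dirichlet_eigenfunction`), and `π f`, normalised, is a left
eigenvector of the generator killed at `v`. On a grid of mesh `d`, each step of the killed chain
multiplies it by `exp (-l d)` up to an error `o(d)` in `ℓ¹`; the errors do not grow, because
transition matrices contract `ℓ¹`. Paths being right-continuous, the event `H_v > t` is the limit
of its grid versions, and so `P(H_v > t, X_t = b) = exp (-l t) μ(b)` exactly
(`real_lt_hitTime_inter`). Hence `μ` is quasistationary, `H_v` is exponential with rate `l`, and
`E[H_v] = 1 / l`.
-/

namespace MeetingTime

open Matrix

variable {V : Type*} [Fintype V] [DecidableEq V]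

/-! ### The generator, the Dirichlet form and the Dirichlet eigenvalue -/

theorem generator_mulVec (q : V → V → ℝ) (g : V → ℝ) (x : V) :
    (generator q *ᵥ g) x = ∑ y, q x y * (g x - g y) := by
  have h : ∀ y, generator q x y * g y
      = (if x = y then (∑ z ∈ Finset.univ.erase x, q x z) * g x + q x x * g x else 0)
        - q x y * g y := by
    intro y
    by_cases hxy : x = y
    · subst hxy; simp [generator]
    · simp [generator, hxy]
  simp only [mulVec, dotProduct, h, Finset.sum_sub_distrib, Finset.sum_ite_eq, Finset.mem_univ,
    if_true, mul_sub, ← Finset.sum_mul]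
  rw [← Finset.sum_erase_add _ (q x) (Finset.mem_univ x)]
  ring

/-- In a reversible chain, a density `f` with respect to `π` evolves by the generator itself. -/
theorem vecMul_generator {q : V → V → ℝ} {π : V → ℝ} (hrev : IsReversible q π) (f : V → ℝ)
    (b : V) : ((fun x => π x * f x) ᵥ* generator q) b = π b * (generator q *ᵥ f) b := by
  simp only [vecMul, mulVec, dotProduct, Finset.mul_sum]
  refine Finset.sum_congr rfl fun x _ => ?_
  by_cases hxb : x = b
  · subst hxb; ring
  · simp only [generator, of_apply, if_neg hxb, if_neg (Ne.symm hxb)]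
    linear_combination -f x * hrev x b hxb

omit [DecidableEq V] in
/-- The stationary distribution of an irreducible reversible chain is strictly positive. -/
theorem IsReversible.pos {q : V → V → ℝ} {π : V → ℝ} (hirr : IsIrreducible q)
    (hrev : IsReversible q π) (hπ : π ∈ stdSimplex ℝ V) (x : V) : 0 < π x := by
  by_contra hx
  have hne : ({x | 0 < π x} : Set V).Nonempty := by
    by_contra hemp
    rw [Set.not_nonempty_iff_eq_empty] at hemp
    have h0 : ∀ y, π y = 0 := fun y =>
      le_antisymm (not_lt.1 fun h => (hemp ▸ (show y ∈ {x | 0 < π x} from h) : y ∈ (∅ : Set V)))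
        (hπ.1 y)
    have := hπ.2
    simp [h0] at this
  obtain ⟨a, ha, b, hb, hab⟩ := hirr {x | 0 < π x} hne ⟨x, hx⟩
  have hb0 : π b = 0 := le_antisymm (not_lt.1 hb) (hπ.1 b)
  have hne : a ≠ b := fun h => hb (h ▸ ha)
  have := hrev a b hne
  rw [hb0, zero_mul] at this
  exact (mul_ne_zero (ne_of_gt ha) hab) this

/-- The Dirichlet form `⟨f, Q g⟩` in `L²(π)`. -/
noncomputable def dirichletForm (q : V → V → ℝ) (π f g : V → ℝ) : ℝ :=
  ∑ x, π x * f x * (generator q *ᵥ g) x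

theorem dirichletForm_eq {q : V → V → ℝ} {π : V → ℝ} (hrev : IsReversible q π) (f g : V → ℝ) :
    dirichletForm q π f g
      = 2⁻¹ * ∑ x, ∑ y, π x * q x y * ((f x - f y) * (g x - g y)) := by
  have hrev' : ∀ x y, π x * q x y = π y * q y x := fun x y => by
    by_cases h : x = y
    · rw [h]
    · exact hrev x y h
  have h1 : dirichletForm q π f g = ∑ x, ∑ y, π x * q x y * (f x * (g x - g y)) := by
    simp only [dirichletForm, generator_mulVec, Finset.mul_sum]
    exact Finset.sum_congr rfl fun x _ => Finset.sum_congr rfl fun y _ => by ring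
  have h2 : dirichletForm q π f g = ∑ x, ∑ y, π x * q x y * (f y * (g y - g x)) := by
    rw [h1, Finset.sum_comm]
    exact Finset.sum_congr rfl fun x _ => Finset.sum_congr rfl fun y _ => by rw [hrev' y x]
  have h3 : ∑ x, ∑ y, π x * q x y * ((f x - f y) * (g x - g y))
      = dirichletForm q π f g + dirichletForm q π f g := by
    nth_rewrite 1 [h1]
    rw [h2, ← Finset.sum_add_distrib]
    refine Finset.sum_congr rfl fun x _ => ?_
    rw [← Finset.sum_add_distrib]
    exact Finset.sum_congr rfl fun y _ => by ring
  rw [h3]; ring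

theorem dirichletForm_add_smul {q : V → V → ℝ} {π : V → ℝ} (hrev : IsReversible q π)
    (f g : V → ℝ) (c : ℝ) :
    dirichletForm q π (f + c • g) (f + c • g)
      = dirichletForm q π f f + 2 * c * dirichletForm q π g f
        + c ^ 2 * dirichletForm q π g g := by
  simp only [dirichletForm_eq hrev, Finset.mul_sum, ← Finset.sum_add_distrib, Pi.add_apply,
    Pi.smul_apply, smul_eq_mul]
  exact Finset.sum_congr rfl fun x _ => Finset.sum_congr rfl fun y _ => by ring

theorem dirichletForm_smul (q : V → V → ℝ) (π f : V → ℝ) (c : ℝ) :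
    dirichletForm q π (c • f) (c • f) = c ^ 2 * dirichletForm q π f f := by
  simp only [dirichletForm, mulVec_smul, Finset.mul_sum, Pi.smul_apply, smul_eq_mul]
  exact Finset.sum_congr rfl fun x _ => by ring

section Reversible

variable {q : V → V → ℝ} (hq : ∀ x y, x ≠ y → 0 ≤ q x y) {π : V → ℝ} (hπ : ∀ x, 0 < π x)
  (hrev : IsReversible q π)

omit [Fintype V] in
include hq hπ in
theorem dirichlet_summand_nonneg (f : V → ℝ) (x y : V) :
    0 ≤ π x * q x y * ((f x - f y) * (f x - f y)) := by
  by_cases h : x = y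
  · simp [h]
  · exact mul_nonneg (mul_nonneg (hπ x).le (hq x y h)) (mul_self_nonneg _)

include hq hπ hrev in
theorem dirichletForm_nonneg (f : V → ℝ) : 0 ≤ dirichletForm q π f f := by
  rw [dirichletForm_eq hrev]
  exact mul_nonneg (by norm_num) (Finset.sum_nonneg fun x _ => Finset.sum_nonneg fun y _ =>
    dirichlet_summand_nonneg hq hπ f x y)

include hq hπ hrev in
theorem dirichletForm_abs_le (f : V → ℝ) :
    dirichletForm q π (fun x => |f x|) (fun x => |f x|) ≤ dirichletForm q π f f := by
  rw [dirichletForm_eq hrev, dirichletForm_eq hrev]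
  refine mul_le_mul_of_nonneg_left (Finset.sum_le_sum fun x _ => Finset.sum_le_sum fun y _ => ?_)
    (by norm_num)
  by_cases h : x = y
  · simp [h]
  · refine mul_le_mul_of_nonneg_left ?_ (mul_nonneg (hπ x).le (hq x y h))
    nlinarith [abs_mul_abs_self (f x), abs_mul_abs_self (f y), le_abs_self (f x * f y),
      abs_mul (f x) (f y)]

include hq hπ hrev in
/-- A function of zero energy is constant, by irreducibility. -/
theorem eq_of_dirichletForm_eq_zero (hirr : IsIrreducible q) {f : V → ℝ}
    (hf : dirichletForm q π f f = 0) (x v : V) : f x = f v := by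
  by_contra hx
  obtain ⟨a, ha, b, hb, hab⟩ := hirr {y | f y = f v} ⟨v, rfl⟩ ⟨x, hx⟩
  rw [dirichletForm_eq hrev, mul_eq_zero, or_iff_right (by norm_num),
    Finset.sum_eq_zero_iff_of_nonneg fun x _ => Finset.sum_nonneg fun y _ =>
      dirichlet_summand_nonneg hq hπ f x y] at hf
  have h1 := (Finset.sum_eq_zero_iff_of_nonneg fun y _ =>
    dirichlet_summand_nonneg hq hπ f a y).1 (hf a (Finset.mem_univ a)) b (Finset.mem_univ b)
  have h2 : f a - f b ≠ 0 := fun h => hb ((sub_eq_zero.1 h).symm.trans ha)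
  exact mul_ne_zero (mul_ne_zero (hπ a).ne' hab) (mul_ne_zero h2 h2) h1

omit [DecidableEq V] in
include hπ in
theorem isCompact_unit_vanishing (v : V) :
    IsCompact {f : V → ℝ | f v = 0 ∧ ∑ x, π x * f x ^ 2 = 1} := by
  refine IsCompact.of_isClosed_subset
    (isCompact_univ_pi fun x => isCompact_Icc (a := -(1 + (π x)⁻¹)) (b := 1 + (π x)⁻¹)) ?_ ?_
  · exact (isClosed_eq (by fun_prop) (by fun_prop)).inter
      (isClosed_eq (by fun_prop) (by fun_prop))
  · rintro f ⟨-, hf⟩ x -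
    have h1 : π x * f x ^ 2 ≤ 1 := hf ▸ Finset.single_le_sum
      (f := fun x => π x * f x ^ 2) (fun y _ => by have := hπ y; positivity) (Finset.mem_univ x)
    have h2 : f x ^ 2 ≤ (π x)⁻¹ := by
      rw [← mul_inv_cancel_left₀ (hπ x).ne' (f x ^ 2), mul_left_comm]
      exact mul_le_of_le_one_right (inv_pos.2 (hπ x)).le h1 |>.trans_eq' (by ring)
    have h3 : |f x| ≤ 1 + (π x)⁻¹ := by
      nlinarith [abs_nonneg (f x), sq_abs (f x), sq_nonneg (|f x| - 1)]
    exact abs_le.1 h3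

include hq hπ hrev in
/-- The principal Dirichlet eigenvalue `l` of `Q` on `V \ {v}`. It minimises the Rayleigh quotient,
and since replacing a minimiser by its absolute value does not increase the energy, it has a
nonnegative eigenfunction `f`. It is positive by irreducibility. -/
theorem exists_dirichlet_eigenfunction [Nontrivial V] (hirr : IsIrreducible q) (v : V) :
    ∃ (l : ℝ) (f : V → ℝ), 0 < l ∧ (∀ x, 0 ≤ f x) ∧ f v = 0 ∧ ∑ x, π x * f x ^ 2 = 1 ∧
      (∀ x, x ≠ v → (generator q *ᵥ f) x = l * f x) ∧
      ∀ g : V → ℝ, g v = 0 → l * ∑ x, π x * g x ^ 2 ≤ dirichletForm q π g g := by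
  have hcont : Continuous fun f : V → ℝ => dirichletForm q π f f := by
    simp only [dirichletForm_eq hrev]; fun_prop
  have hne : ({f : V → ℝ | f v = 0 ∧ ∑ x, π x * f x ^ 2 = 1}).Nonempty := by
    obtain ⟨w, hw⟩ := exists_ne v
    refine ⟨Pi.single w (Real.sqrt (π w))⁻¹, Pi.single_eq_of_ne hw.symm _, ?_⟩
    rw [Finset.sum_eq_single w (fun b _ hb => by simp [Pi.single_eq_of_ne hb]) (by simp),
      Pi.single_eq_same, inv_pow, Real.sq_sqrt (hπ w).le, mul_inv_cancel₀ (hπ w).ne']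
  obtain ⟨f₀, ⟨hf₀v, hf₀n⟩, hmin⟩ :=
    (isCompact_unit_vanishing hπ v).exists_isMinOn hne hcont.continuousOn
  set f : V → ℝ := fun x => |f₀ x| with hf
  have hfv : f v = 0 := by simp [hf, hf₀v]
  have hfn : ∑ x, π x * f x ^ 2 = 1 := by simpa [hf] using hf₀n
  set l := dirichletForm q π f f with hl
  have hlmin : ∀ g : V → ℝ, g v = 0 → l * ∑ x, π x * g x ^ 2 ≤ dirichletForm q π g g := by
    intro g hg
    have hN0 : 0 ≤ ∑ x, π x * g x ^ 2 :=
      Finset.sum_nonneg fun y _ => mul_nonneg (hπ y).le (sq_nonneg _)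
    rcases hN0.eq_or_lt with h0 | h0
    · rw [← h0, mul_zero]; exact dirichletForm_nonneg hq hπ hrev g
    set c := (Real.sqrt (∑ x, π x * g x ^ 2))⁻¹ with hc
    have hc2 : c ^ 2 * ∑ x, π x * g x ^ 2 = 1 := by
      rw [hc, inv_pow, Real.sq_sqrt hN0, inv_mul_cancel₀ h0.ne']
    have hmem : c • g ∈ {f : V → ℝ | f v = 0 ∧ ∑ x, π x * f x ^ 2 = 1} := by
      refine ⟨by simp [hg], ?_⟩
      rw [← hc2, Finset.mul_sum]
      exact Finset.sum_congr rfl fun x _ => by simp only [Pi.smul_apply, smul_eq_mul]; ring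
    have h1 : l ≤ c ^ 2 * dirichletForm q π g g := by
      rw [← dirichletForm_smul]
      exact (dirichletForm_abs_le hq hπ hrev f₀).trans (hmin hmem)
    calc l * ∑ x, π x * g x ^ 2
        ≤ (c ^ 2 * dirichletForm q π g g) * ∑ x, π x * g x ^ 2 :=
          mul_le_mul_of_nonneg_right h1 hN0
      _ = (c ^ 2 * ∑ x, π x * g x ^ 2) * dirichletForm q π g g := by ring
      _ = dirichletForm q π g g := by rw [hc2, one_mul]
  have hlpos : 0 < l := by
    refine (dirichletForm_nonneg hq hπ hrev f).lt_of_ne fun h0 => ?_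
    have hz : ∀ x, f x = 0 := fun x =>
      (eq_of_dirichletForm_eq_zero hq hπ hrev hirr h0.symm x v).trans hfv
    simp [hz] at hfn
  refine ⟨l, f, hlpos, fun x => abs_nonneg _, hfv, hfn, fun x hx => ?_, hlmin⟩
  -- The first variation of the energy in the direction of the unit mass at `x` vanishes.
  set g : V → ℝ := Pi.single x 1 with hg
  have hgv : g v = 0 := Pi.single_eq_of_ne hx.symm _
  have hgf : dirichletForm q π g f = π x * (generator q *ᵥ f) x := by
    rw [dirichletForm, Finset.sum_eq_single x (fun b _ hb => by simp [hg, Pi.single_eq_of_ne hb])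
      (by simp)]
    simp [hg]
  have hgn : ∀ c : ℝ, ∑ y, π y * (f + c • g) y ^ 2 = 1 + 2 * c * (π x * f x) + c ^ 2 * π x := by
    intro c
    have : ∀ y, π y * (f + c • g) y ^ 2
        = π y * f y ^ 2 + if y = x then 2 * c * (π x * f x) + c ^ 2 * π x else 0 := by
      intro y
      by_cases hy : y = x
      · subst hy; simp [hg]; ring
      · simp [hg, hy]
    simp only [this, Finset.sum_add_distrib, hfn, Finset.sum_ite_eq', Finset.mem_univ, if_true]
    ring
  set d := π x * (generator q *ᵥ f) x - l * (π x * f x) with hd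
  set e := dirichletForm q π g g - l * π x with he
  have hquad : ∀ c : ℝ, 0 ≤ e * (c * c) + 2 * d * c + 0 := by
    intro c
    have h := hlmin (f + c • g) (by simp [hfv, hgv])
    rw [dirichletForm_add_smul hrev, hgn, hgf, ← hl] at h
    rw [hd, he]; linarith
  have hdisc := discrim_le_zero hquad
  have hd0 : d = 0 := by
    rw [discrim] at hdisc
    nlinarith [sq_nonneg d]
  rw [hd, sub_eq_zero] at hd0
  exact mul_left_cancel₀ (hπ x).ne' (by rw [hd0]; ring)

end Reversible

/-! ### Short-time expansion of the semigroup -/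

/-- First-order Taylor expansion at `0`, uniformly over a finite family of functions. -/
theorem exists_uniform_linear_approx {ι : Type*} [Fintype ι] {F : ι → ℝ → ℝ} {F' : ι → ℝ}
    (hF : ∀ i, HasDerivAt (F i) (F' i) 0) {ε : ℝ} (hε : 0 < ε) :
    ∃ η > 0, ∀ d : ℝ, 0 ≤ d → d < η → ∀ i, |F i d - F i 0 - d * F' i| ≤ ε * d := by
  have h : ∀ᶠ d in nhds (0 : ℝ), ∀ i, |F i d - F i 0 - d * F' i| ≤ ε * |d| := by
    rw [eventually_all]
    intro i
    have := (hasDerivAt_iff_isLittleO.1 (hF i)).def hε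
    simpa using this
  obtain ⟨η, hη, h⟩ := Metric.eventually_nhds_iff.1 h
  refine ⟨η, hη, fun d hd hdη i => ?_⟩
  have := h (y := d) (by rwa [Real.dist_eq, sub_zero, abs_of_nonneg hd]) i
  rwa [abs_of_nonneg hd] at this

/-- The transition matrix `e^{-dQ}` over a time `d`. -/
noncomputable abbrev transition (q : V → V → ℝ) (d : ℝ) : Matrix V V ℝ :=
  NormedSpace.exp ((-d) • generator q)

theorem transition_zero (q : V → V → ℝ) : transition q 0 = 1 := by
  simp [transition]

open scoped Matrix.Norms.Operator in
theorem hasDerivAt_transition (q : V → V → ℝ) (x y : V) :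
    HasDerivAt (fun d => transition q d x y) (-generator q x y) 0 := by
  have h1 : HasDerivAt (fun d : ℝ => NormedSpace.exp (d • -generator q)) (-generator q) 0 := by
    have h := hasDerivAt_exp_smul_const (𝕂 := ℝ) (-generator q) 0
    rwa [zero_smul, NormedSpace.exp_zero, one_mul] at h
  have h2 := (Matrix.entryLinearMap ℝ ℝ x y : Matrix V V ℝ →ₗ[ℝ] ℝ).toContinuousLinearMap
    |>.hasFDerivAt.comp_hasDerivAt (0 : ℝ) h1
  simp only [smul_neg, ← neg_smul] at h2
  exact h2

/-- The squared norm of the density `a / π` in `L²(π)`. -/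
noncomputable def densityNormSq (π a : V → ℝ) : ℝ := ∑ b, a b ^ 2 / π b

omit [DecidableEq V] in
theorem sq_sum_abs_le_densityNormSq {π : V → ℝ} (hπ : ∀ x, 0 < π x) (hπ1 : ∑ x, π x = 1)
    (a : V → ℝ) : (∑ x, |a x|) ^ 2 ≤ densityNormSq π a := by
  have h := Finset.sum_sq_le_sum_mul_sum_of_sq_le_mul Finset.univ
    (r := fun x => |a x|) (f := fun x => a x ^ 2 / π x) (g := π)
    (fun x _ => div_nonneg (sq_nonneg _) (hπ x).le) (fun x _ => (hπ x).le)
    (fun x _ => by rw [sq_abs, div_mul_cancel₀ _ (hπ x).ne'])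
  rwa [hπ1, mul_one] at h

theorem densityNormSq_update_le {π : V → ℝ} (hπ : ∀ x, 0 < π x) (a : V → ℝ) (w : V) :
    densityNormSq π (Function.update a w 0) ≤ densityNormSq π a := by
  refine Finset.sum_le_sum fun b _ => ?_
  have hb := hπ b
  by_cases h : b = w
  · subst h
    rw [Function.update_self, zero_pow two_ne_zero, zero_div]
    positivity
  · rw [Function.update_of_ne h]

/-- If every function vanishing somewhere has Rayleigh quotient at least `l`, then the semigroup,
applied for a short time `d` to a density that vanishes somewhere, contracts the squared norm by
`exp (-2 l d)` up to a relative error `exp (o(d))`. -/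
theorem exists_densityNormSq_le {q : V → V → ℝ} {π : V → ℝ} (hπ : ∀ x, 0 < π x)
    (hπ1 : ∑ x, π x = 1) (hrev : IsReversible q π) {l : ℝ}
    (hl : ∀ w, ∀ g : V → ℝ, g w = 0 → l * ∑ x, π x * g x ^ 2 ≤ dirichletForm q π g g)
    {ε : ℝ} (hε : 0 < ε) :
    ∃ η > 0, ∀ d : ℝ, 0 ≤ d → d < η → ∀ (a : V → ℝ) (w : V), a w = 0 →
      densityNormSq π (a ᵥ* transition q d) ≤ Real.exp (d * (ε - 2 * l)) * densityNormSq π a := by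
  -- The squared norm of `a e^{-dQ}` is a quadratic form in `a`; its coefficients are expanded at
  -- `d = 0`, and the linear terms add up to `-2` times the Dirichlet form of `a / π`.
  have hder : ∀ p : V × V, HasDerivAt
      (fun d => ∑ b, transition q d p.1 b * transition q d p.2 b / π b)
      (-(generator q p.1 p.2 / π p.2) - generator q p.2 p.1 / π p.1) 0 := by
    rintro ⟨x, y⟩
    have h := HasDerivAt.fun_sum (u := Finset.univ) fun b _ =>
      ((hasDerivAt_transition q x b).mul (hasDerivAt_transition q y b)).div_const (π b)
    refine h.congr_deriv ?_
    simp only [transition_zero, one_apply, add_div, Finset.sum_add_distrib, mul_ite, mul_one,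
      mul_zero, ite_mul, one_mul, zero_mul, ite_div, zero_div, Finset.sum_ite_eq,
      Finset.mem_univ, if_true]
    ring
  obtain ⟨η, hη, H⟩ := exists_uniform_linear_approx hder hε
  refine ⟨η, hη, fun d hd hdη a w haw => ?_⟩
  set f : V → ℝ := fun x => a x / π x with hf
  have haf : a = fun x => π x * f x := funext fun x => (mul_div_cancel₀ _ (hπ x).ne').symm
  have hN : densityNormSq π a = ∑ x, π x * f x ^ 2 := by
    refine Finset.sum_congr rfl fun x _ => ?_
    have := (hπ x).ne'
    simp only [hf]; field_simp
  have hN0 : 0 ≤ densityNormSq π a :=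
    Finset.sum_nonneg fun b _ => div_nonneg (sq_nonneg _) (hπ b).le
  have hE1 : ∑ x, ∑ y, a x * a y * (generator q x y / π y) = dirichletForm q π f f := by
    rw [Finset.sum_comm]
    refine Finset.sum_congr rfl fun y _ => ?_
    have h := vecMul_generator hrev f y
    rw [← haf, vecMul, dotProduct] at h
    have hy := (hπ y).ne'
    rw [mul_right_comm, ← h, Finset.sum_mul]
    refine Finset.sum_congr rfl fun x _ => ?_
    simp only [hf]; ring
  have hE2 : ∑ x, ∑ y, a x * a y * (generator q y x / π x) = dirichletForm q π f f := by
    rw [← hE1, Finset.sum_comm]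
    exact Finset.sum_congr rfl fun x _ => Finset.sum_congr rfl fun y _ => by ring
  have hM0 : ∑ x, ∑ y, a x * a y * ∑ b, transition q 0 x b * transition q 0 y b / π b
      = densityNormSq π a := by
    refine Finset.sum_congr rfl fun x _ => ?_
    simp [transition_zero, one_apply, ite_div]
    ring
  have hM : densityNormSq π (a ᵥ* transition q d)
      = ∑ x, ∑ y, a x * a y * ∑ b, transition q d x b * transition q d y b / π b := by
    have hb : ∀ b, (a ᵥ* transition q d) b ^ 2 / π b
        = ∑ x, ∑ y, a x * a y * (transition q d x b * transition q d y b / π b) := by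
      intro b
      rw [vecMul, dotProduct, sq, Finset.sum_mul_sum, Finset.sum_div]
      refine Finset.sum_congr rfl fun x _ => ?_
      rw [Finset.sum_div]
      exact Finset.sum_congr rfl fun y _ => by ring
    simp only [densityNormSq, hb, Finset.mul_sum]
    rw [Finset.sum_comm]
    exact Finset.sum_congr rfl fun x _ => Finset.sum_comm
  have hCS := sq_sum_abs_le_densityNormSq hπ hπ1 a
  have hle : densityNormSq π (a ᵥ* transition q d)
      ≤ densityNormSq π a - 2 * d * dirichletForm q π f f + ε * d * (∑ x, |a x|) ^ 2 := by
    have hR : (∑ x, |a x|) ^ 2 = ∑ x, ∑ y, |a x| * |a y| := by rw [sq, Finset.sum_mul_sum]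
    have h2 : densityNormSq π a - 2 * d * dirichletForm q π f f + ε * d * (∑ x, |a x|) ^ 2
        = ∑ x, ∑ y, (a x * a y * ∑ b, transition q 0 x b * transition q 0 y b / π b
          - d * (a x * a y * (generator q x y / π y))
          - d * (a x * a y * (generator q y x / π x)) + ε * d * (|a x| * |a y|)) := by
      simp only [Finset.sum_add_distrib, Finset.sum_sub_distrib, ← Finset.mul_sum]
        at hR hM0 hE1 hE2 ⊢
      rw [hR, hM0, hE1, hE2]; ring
    rw [hM, h2]
    refine Finset.sum_le_sum fun x _ => Finset.sum_le_sum fun y _ => ?_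
    have h3 := mul_le_mul_of_nonneg_left (H d hd hdη (x, y)) (abs_nonneg (a x * a y))
    rw [← abs_mul] at h3
    have h4 := (le_abs_self _).trans h3
    rw [abs_mul (a x)] at h4
    simp only at h4
    linarith
  have hfw : f w = 0 := by simp [hf, haw]
  have hlf := hl w f hfw
  rw [← hN] at hlf
  calc densityNormSq π (a ᵥ* transition q d)
      ≤ densityNormSq π a - 2 * d * dirichletForm q π f f + ε * d * (∑ x, |a x|) ^ 2 := hle
    _ ≤ densityNormSq π a - 2 * d * (l * densityNormSq π a) + ε * d * densityNormSq π a := by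
        gcongr
    _ = (d * (ε - 2 * l) + 1) * densityNormSq π a := by ring
    _ ≤ Real.exp (d * (ε - 2 * l)) * densityNormSq π a :=
        mul_le_mul_of_nonneg_right (Real.add_one_le_exp _) hN0

/-! ### Finite-dimensional distributions of the chain -/

omit [Fintype V] [DecidableEq V] in
theorem past_le (s : ℝ≥0) : past V s ≤ instMeasurableSpacePathSpace V :=
  iSup₂_le fun r _ => le_iSup (fun t : ℝ≥0 => MeasurableSpace.comap (X (V := V) t) ⊤) r

omit [Fintype V] [DecidableEq V] in
theorem measurableSet_past_X {r s : ℝ≥0} (h : r ≤ s) (A : Set V) :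
    MeasurableSet[past V s] {ω | X r ω ∈ A} :=
  le_iSup₂_of_le (f := fun r (_ : r ∈ Set.Iic s) => MeasurableSpace.comap (X (V := V) r) ⊤)
    r h le_rfl _ ⟨A, trivial, rfl⟩

omit [Fintype V] [DecidableEq V] in
theorem measurableSet_X (t : ℝ≥0) (A : Set V) : MeasurableSet {ω | X t ω ∈ A} :=
  past_le t _ (measurableSet_past_X le_rfl A)

omit [Fintype V] [DecidableEq V] in
theorem measurableSet_X_eq (t : ℝ≥0) (y : V) : MeasurableSet {ω | X t ω = y} :=
  measurableSet_X t {y}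

omit [DecidableEq V] in
/-- A probability is the sum over the possible values of `X s`. -/
theorem sum_real_inter_X_eq (μ : Measure (PathSpace V)) [IsFiniteMeasure μ]
    {F : Set (PathSpace V)} (hF : MeasurableSet F) (s : ℝ≥0) :
    ∑ z, μ.real (F ∩ {ω | X s ω = z}) = μ.real F := by
  rw [← measureReal_iUnion_fintype]
  · congr 1; ext ω; simp
  · intro y z hyz
    exact Set.disjoint_left.2 fun ω h1 h2 => hyz (h1.2.symm.trans h2.2)
  · exact fun z => hF.inter (measurableSet_X_eq s z)

variable {q : V → V → ℝ} {P : V → Measure (PathSpace V)}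

namespace IsChainLaw

variable (hP : IsChainLaw q P)
include hP

/-- The Markov property, in integrated form. -/
theorem real_inter_X_add (x : V) {s : ℝ≥0} (t : ℝ≥0) (y : V) {F : Set (PathSpace V)}
    (hF : MeasurableSet[past V s] F) :
    (P x).real (F ∩ {ω | X (s + t) ω = y})
      = ∑ z, (P x).real (F ∩ {ω | X s ω = z}) * transition q t z y := by
  have := hP.isProbabilityMeasure x
  have hF' := past_le s F hF
  have hint : Integrable (Set.indicator {ω | X (s + t) ω = y} (fun _ => (1 : ℝ))) (P x) :=
    (integrable_const 1).indicator (measurableSet_X_eq _ _)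
  have h1 := setIntegral_condExp (past_le s) hint hF
  rw [setIntegral_congr_ae hF' ((hP.markov x s t y).mono fun ω h _ => h),
    integral_indicator_const _ (measurableSet_X_eq _ _), smul_eq_mul, mul_one,
    measureReal_restrict_apply (measurableSet_X_eq _ _)] at h1
  rw [Set.inter_comm, ← h1]
  have h2 : ∀ ω : PathSpace V, transition q t (X s ω) y
      = ∑ z, Set.indicator {ω | X s ω = z} (fun _ => transition q t z y) ω := by
    intro ω
    rw [Finset.sum_eq_single (X s ω)]
    · simp
    · intro z _ hz
      exact Set.indicator_of_notMem (fun h => hz h.symm) _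
    · simp
  simp only [transition] at h2
  simp only [h2]
  rw [integral_finsetSum _ fun z _ => (integrable_const _).indicator (measurableSet_X_eq _ _)]
  refine Finset.sum_congr rfl fun z _ => ?_
  rw [integral_indicator_const _ (measurableSet_X_eq _ _),
    measureReal_restrict_apply (measurableSet_X_eq _ _), Set.inter_comm, smul_eq_mul]

theorem real_X_zero (x z : V) : (P x).real {ω | X 0 ω = z} = if x = z then 1 else 0 := by
  have := hP.isProbabilityMeasure x
  split_ifs with h
  · subst h; simp [measureReal_def, hP.start x]
  · have h1 : (P x) {ω | X 0 ω = x}ᶜ = 0 :=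
      (prob_compl_eq_zero_iff (measurableSet_X_eq 0 x)).2 (hP.start x)
    have h2 : {ω | X 0 ω = z} ⊆ {ω | X 0 ω = x}ᶜ := fun ω hω hx => h (Eq.trans (Eq.symm hx) hω)
    rw [measureReal_def, measure_mono_null h2 h1, ENNReal.toReal_zero]

theorem real_X_eq (x : V) (t : ℝ≥0) (y : V) :
    (P x).real {ω | X t ω = y} = transition q t x y := by
  have h := hP.real_inter_X_add x (s := 0) t y (F := Set.univ) MeasurableSet.univ
  simpa [hP.real_X_zero] using h

theorem transition_nonneg (t : ℝ≥0) (x y : V) : 0 ≤ transition q t x y := by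
  rw [← hP.real_X_eq]; exact measureReal_nonneg

theorem sum_transition (t : ℝ≥0) (x : V) : ∑ y, transition q t x y = 1 := by
  have := hP.isProbabilityMeasure x
  simp only [← hP.real_X_eq]
  have := sum_real_inter_X_eq (P x) MeasurableSet.univ t
  simpa using this

/-- The transition matrix does not increase the `ℓ¹` norm of a row vector. -/
theorem sum_abs_vecMul_le (t : ℝ≥0) (a : V → ℝ) :
    ∑ b, |(a ᵥ* transition q t) b| ≤ ∑ b, |a b| := by
  calc ∑ b, |(a ᵥ* transition q t) b| ≤ ∑ b, ∑ x, |a x| * transition q t x b := by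
        refine Finset.sum_le_sum fun b _ => (Finset.abs_sum_le_sum_abs _ _).trans_eq ?_
        exact Finset.sum_congr rfl fun x _ => by
          rw [abs_mul, abs_of_nonneg (hP.transition_nonneg t x b)]
    _ = ∑ b, |a b| := by
        rw [Finset.sum_comm]
        exact Finset.sum_congr rfl fun x _ => by rw [← Finset.mul_sum, hP.sum_transition, mul_one]

end IsChainLaw

theorem lawFrom_real (hP : IsChainLaw q P) {μ : V → ℝ} (hμ : ∀ x, 0 ≤ μ x)
    (S : Set (PathSpace V)) : (lawFrom P μ).real S = ∑ x, μ x * (P x).real S := by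
  have := hP.isProbabilityMeasure
  rw [lawFrom, measureReal_def, Measure.finsetSum_apply, ENNReal.toReal_sum]
  · exact Finset.sum_congr rfl fun x _ => by
      rw [Measure.smul_apply, smul_eq_mul, ENNReal.toReal_mul, ENNReal.toReal_ofReal (hμ x),
        measureReal_def]
  · intro x _
    rw [Measure.smul_apply, smul_eq_mul]
    finiteness

theorem isProbabilityMeasure_lawFrom (hP : IsChainLaw q P) {μ : V → ℝ} (hμ : μ ∈ stdSimplex ℝ V) :
    IsProbabilityMeasure (lawFrom P μ) := by
  have := hP.isProbabilityMeasure
  constructor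
  simp only [lawFrom, Measure.finsetSum_apply, Measure.smul_apply, smul_eq_mul, measure_univ,
    mul_one]
  rw [← ENNReal.ofReal_sum_of_nonneg fun x _ => hμ.1 x, hμ.2, ENNReal.ofReal_one]

/-! ### Avoiding a path on a time grid -/

/-- The event that the chain avoids `h` at the times `0, d, 2 d, …, k d`. -/
def avoidGrid (h : ℝ≥0 → V) (d : ℝ≥0) (k : ℕ) : Set (PathSpace V) :=
  {ω | ∀ i : ℕ, i ≤ k → X (i * d) ω ≠ h (i * d)}

omit [Fintype V] [DecidableEq V] in
theorem measurableSet_past_avoidGrid (h : ℝ≥0 → V) (d : ℝ≥0) (k : ℕ) :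
    MeasurableSet[past V (k * d)] (avoidGrid h d k) := by
  have : avoidGrid h d k = ⋂ i : ℕ, ⋂ (_ : i ≤ k), {ω | X (i * d) ω ∈ ({h (i * d)}ᶜ : Set V)} := by
    ext ω; simp [avoidGrid]
  rw [this]
  refine MeasurableSet.iInter fun i => MeasurableSet.iInter fun hi => ?_
  exact measurableSet_past_X (by gcongr) _

omit [Fintype V] [DecidableEq V] in
theorem measurableSet_avoidGrid (h : ℝ≥0 → V) (d : ℝ≥0) (k : ℕ) :
    MeasurableSet (avoidGrid h d k) :=
  past_le _ _ (measurableSet_past_avoidGrid h d k)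

/-- The mass at `b` of the chain at time `k d`, started from `μ` and killed when it meets `h` at
one of the times `0, d, 2 d, …, k d`. -/
noncomputable def gridMass (P : V → Measure (PathSpace V)) (μ : V → ℝ) (h : ℝ≥0 → V) (d : ℝ≥0)
    (k : ℕ) (b : V) : ℝ :=
  (lawFrom P μ).real (avoidGrid h d k ∩ {ω | X (k * d) ω = b})

omit [DecidableEq V] in
theorem gridMass_self (μ : V → ℝ) (h : ℝ≥0 → V) (d : ℝ≥0) (k : ℕ) :
    gridMass P μ h d k (h (k * d)) = 0 := by
  have : avoidGrid h d k ∩ {ω | X (k * d) ω = h (k * d)} = ∅ :=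
    Set.eq_empty_of_forall_notMem fun ω hω => hω.1 k le_rfl hω.2
  rw [gridMass, this, measureReal_empty]

theorem gridMass_zero (hP : IsChainLaw q P) {μ : V → ℝ} (hμ : ∀ x, 0 ≤ μ x) (h : ℝ≥0 → V)
    (d : ℝ≥0) : gridMass P μ h d 0 = Function.update μ (h 0) 0 := by
  ext b
  by_cases hb : b = h 0
  · subst hb
    simpa using gridMass_self (P := P) μ h d 0
  · have : avoidGrid h d 0 ∩ {ω | X ((0 : ℕ) * d) ω = b} = {ω | X 0 ω = b} := by
      ext ω
      simp only [avoidGrid, Nat.le_zero, Set.mem_inter_iff, Set.mem_ofPred_eq, forall_eq,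
        Nat.cast_zero, zero_mul]
      exact ⟨fun h => h.2, fun h => ⟨h ▸ hb, h⟩⟩
    rw [gridMass, this, lawFrom_real hP hμ, Function.update_of_ne hb]
    simp [hP.real_X_zero]

theorem gridMass_succ (hP : IsChainLaw q P) {μ : V → ℝ} (hμ : ∀ x, 0 ≤ μ x) (h : ℝ≥0 → V)
    (d : ℝ≥0) (k : ℕ) : gridMass P μ h d (k + 1)
      = Function.update (gridMass P μ h d k ᵥ* transition q d) (h ((k + 1 : ℕ) * d)) 0 := by
  ext b
  by_cases hb : b = h ((k + 1 : ℕ) * d)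
  · rw [hb, Function.update_self, gridMass_self]
  · have : avoidGrid h d (k + 1) ∩ {ω | X ((k + 1 : ℕ) * d) ω = b}
        = avoidGrid h d k ∩ {ω | X (k * d + d) ω = b} := by
      ext ω
      have hk : ((k + 1 : ℕ) : ℝ≥0) * d = k * d + d := by push_cast; ring
      rw [← hk]
      constructor
      · exact fun hω => ⟨fun i hi => hω.1 i (by omega), hω.2⟩
      · refine fun hω => ⟨fun i hi => ?_, hω.2⟩
        rcases Nat.lt_or_eq_of_le hi with hi | rfl
        · exact hω.1 i (by omega)
        · exact fun hX => hb (hω.2.symm.trans hX)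
    rw [gridMass, this, Function.update_of_ne hb, lawFrom_real hP hμ]
    simp only [vecMul, dotProduct, gridMass, lawFrom_real hP hμ,
      hP.real_inter_X_add _ _ _ (measurableSet_past_avoidGrid h d k), Finset.mul_sum,
      Finset.sum_mul]
    rw [Finset.sum_comm]
    exact Finset.sum_congr rfl fun z _ => Finset.sum_congr rfl fun x _ => by ring

/-- The probability of avoiding a moving target up to time `t`, started from equilibrium, is at
most `exp (-l t)` if `l` bounds all the principal Dirichlet eigenvalues from below. The path `h`
need not be càdlàg. -/
theorem real_avoid_le (hP : IsChainLaw q P) {π : V → ℝ} (hπ : ∀ x, 0 < π x)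
    (hπ1 : ∑ x, π x = 1) (hrev : IsReversible q π) {l : ℝ}
    (hl : ∀ w, ∀ g : V → ℝ, g w = 0 → l * ∑ x, π x * g x ^ 2 ≤ dirichletForm q π g g)
    (h : ℝ≥0 → V) (t : ℝ≥0) :
    (lawFrom P π).real {ω | ∀ s ≤ t, X s ω ≠ h s} ≤ Real.exp (-(l * t)) := by
  have hπ0 : ∀ x, 0 ≤ π x := fun x => (hπ x).le
  have := isProbabilityMeasure_lawFrom hP (μ := π) ⟨hπ0, hπ1⟩
  set p := (lawFrom P π).real {ω | ∀ s ≤ t, X s ω ≠ h s} with hp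
  -- A grid so fine that the error of each of its steps is controlled by `ε`.
  have key : ∀ ε : ℝ, 0 < ε → p ^ 2 ≤ Real.exp (t * (ε - 2 * l)) := by
    intro ε hε
    obtain ⟨η, hη, H⟩ := exists_densityNormSq_le hπ hπ1 hrev hl hε
    obtain ⟨n, hn⟩ := exists_nat_gt ((t : ℝ) / η)
    have hn0 : (0 : ℝ) < n := lt_of_le_of_lt (by positivity) hn
    have hn0' : (n : ℝ≥0) ≠ 0 := by exact_mod_cast hn0.ne'
    set d : ℝ≥0 := t / n with hd
    have hdη : (d : ℝ) < η := by
      rw [hd, NNReal.coe_div, NNReal.coe_natCast, div_lt_iff₀ hn0]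
      rwa [div_lt_iff₀ hη, mul_comm] at hn
    have hdn : n * d = t := mul_div_cancel₀ _ hn0'
    have hk : ∀ k : ℕ, densityNormSq π (gridMass P π h d k) ≤ Real.exp (k * d * (ε - 2 * l)) := by
      intro k
      induction k with
      | zero =>
        rw [gridMass_zero hP hπ0]
        refine (densityNormSq_update_le hπ _ _).trans ?_
        have : densityNormSq π π = 1 := by
          rw [← hπ1]
          exact Finset.sum_congr rfl fun b _ => by rw [sq, mul_div_cancel_right₀ _ (hπ b).ne']
        simp [this]
      | succ k ih =>
        rw [gridMass_succ hP hπ0]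
        refine (densityNormSq_update_le hπ _ _).trans
          ((H d d.2 hdη _ _ (gridMass_self π h d k)).trans ?_)
        refine (mul_le_mul_of_nonneg_left ih (Real.exp_nonneg _)).trans_eq ?_
        rw [← Real.exp_add]
        congr 1; push_cast; ring
    have hpn : p ≤ ∑ b, |gridMass P π h d n b| := by
      calc p ≤ (lawFrom P π).real (avoidGrid h d n) := by
            refine measureReal_mono fun ω hω i hi => hω _ ?_
            rw [← hdn]; gcongr
        _ = ∑ b, gridMass P π h d n b :=
            (sum_real_inter_X_eq _ (measurableSet_avoidGrid h d n) _).symm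
        _ ≤ _ := Finset.sum_le_sum fun b _ => le_abs_self _
    calc p ^ 2 ≤ (∑ b, |gridMass P π h d n b|) ^ 2 :=
          pow_le_pow_left₀ measureReal_nonneg hpn 2
      _ ≤ densityNormSq π (gridMass P π h d n) := sq_sum_abs_le_densityNormSq hπ hπ1 _
      _ ≤ Real.exp (n * d * (ε - 2 * l)) := hk n
      _ = Real.exp (t * (ε - 2 * l)) := by rw [← hdn]; push_cast; ring_nf
  have hlim : p ^ 2 ≤ Real.exp (t * (0 - 2 * l)) := by
    have hc : Continuous fun ε : ℝ => Real.exp (t * (ε - 2 * l)) := by fun_prop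
    refine ge_of_tendsto ((hc.tendsto 0).mono_left nhdsWithin_le_nhds)
      (eventually_nhdsWithin_of_forall (s := Set.Ioi 0) key)
  refine (pow_le_pow_iff_left₀ measureReal_nonneg (Real.exp_nonneg _) two_ne_zero).1 ?_
  refine hlim.trans_eq ?_
  rw [← Real.exp_nat_mul]
  congr 1; push_cast; ring

/-! ### Hitting times and quasistationary distributions -/

omit [Fintype V] [DecidableEq V] in
theorem IsCadlag.exists_eq_right {ω : ℝ≥0 → V} (hω : IsCadlag ω) (s : ℝ≥0) :
    ∃ u > s, ∀ r, s ≤ r → r < u → ω r = ω s := by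
  obtain ⟨τ, h0, -, hτ, hconst⟩ := hω
  have hex : ∃ j, s < τ j := (hτ.eventually_gt_atTop s).exists
  classical
  have hj := Nat.find_spec hex
  obtain ⟨i, hi⟩ : ∃ i, Nat.find hex = i + 1 := Nat.exists_eq_succ_of_ne_zero fun h => by
    rw [h, h0] at hj; exact not_lt_bot hj
  have hi' : τ i ≤ s := not_lt.1 (Nat.find_min hex (by omega))
  rw [hi] at hj
  exact ⟨τ (i + 1), hj, fun r hr hru =>
    (hconst i r ⟨hi'.trans hr, hru⟩).trans (hconst i s ⟨hi', hj⟩).symm⟩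

omit [Fintype V] [DecidableEq V] in
/-- The infimum defining the hitting time is attained, by right-continuity of the paths. -/
theorem lt_hitTime_iff (v : V) (t : ℝ≥0) (ω : PathSpace V) :
    (t : ℝ≥0∞) < hitTime v ω ↔ ∀ s ≤ t, X s ω ≠ v := by
  constructor
  · intro h s hs hX
    exact (h.trans_le (iInf₂_le s hX)).not_ge (by exact_mod_cast hs)
  · intro h
    obtain ⟨u, hu, hr⟩ := ω.isCadlag.exists_eq_right t
    refine lt_of_lt_of_le (b := (u : ℝ≥0∞)) (by exact_mod_cast hu) (le_iInf₂ fun s hX => ?_)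
    by_contra hlt
    have hsu : s < u := by exact_mod_cast not_le.1 hlt
    rcases le_total s t with hst | hst
    · exact h s hst hX
    · exact h t le_rfl ((hr s hst hsu).symm.trans hX)

omit [Fintype V] [DecidableEq V] in
/-- The event `H_v > t` is the limit of the events of avoiding `v` on finer and finer grids. -/
theorem eventually_mem_avoidGrid_iff (v : V) (t : ℝ≥0) (ω : PathSpace V) :
    ∀ᶠ n : ℕ in atTop, ω ∈ avoidGrid (fun _ => v) (t / (n + 1 : ℕ)) (n + 1) ↔
      ω ∈ {ω | (t : ℝ≥0∞) < hitTime v ω} := by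
  have hpos : ∀ n : ℕ, (0 : ℝ≥0) < (n + 1 : ℕ) := fun n => by positivity
  have hsub : ω ∈ {ω | (t : ℝ≥0∞) < hitTime v ω} → ∀ n : ℕ,
      ω ∈ avoidGrid (fun _ => v) (t / (n + 1 : ℕ)) (n + 1) := by
    intro h n i hi
    refine (lt_hitTime_iff v t ω).1 h _ ?_
    rw [← mul_div_assoc, div_le_iff₀ (hpos n), mul_comm]
    gcongr
  by_cases h : ω ∈ {ω | (t : ℝ≥0∞) < hitTime v ω}
  · exact Eventually.of_forall fun n => ⟨fun _ => h, fun _ => hsub h n⟩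
  have hns := h
  rw [Set.mem_ofPred_eq, lt_hitTime_iff] at hns
  push Not at hns
  obtain ⟨s, hs, hX⟩ := hns
  obtain ⟨u, hu, hr⟩ := ω.isCadlag.exists_eq_right s
  have hlim : Tendsto (fun n : ℕ => s + t / ((n + 1 : ℕ) : ℝ≥0)) atTop (nhds s) := by
    have h1 : Tendsto (fun n : ℕ => t / ((n + 1 : ℕ) : ℝ≥0)) atTop (nhds 0) :=
      (tendsto_const_div_atTop_nhds_zero_nat t).comp (tendsto_add_atTop_nat 1)
    simpa using h1.const_add s
  filter_upwards [hlim.eventually_lt_const hu] with n hn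
  refine iff_of_false (fun hav => ?_) h
  rcases eq_or_ne t 0 with rfl | ht
  · obtain rfl : s = 0 := le_antisymm hs bot_le
    exact hav 0 (Nat.zero_le _) (by simpa using hX)
  -- The first grid point after the hitting time `s` lies before the next jump.
  set m : ℝ≥0 := ((n + 1 : ℕ) : ℝ≥0) with hm
  have hm0 : 0 < m := hpos n
  have hd0 : 0 < t / m := div_pos (pos_iff_ne_zero.2 ht) hm0
  set i := ⌈s / (t / m)⌉₊ with hi
  have hle : s ≤ i * (t / m) := (div_le_iff₀ hd0).1 (Nat.le_ceil _)
  have hlt : i * (t / m) < s + t / m := by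
    have := Nat.ceil_lt_add_one (a := s / (t / m)) bot_le
    calc (i : ℝ≥0) * (t / m) < (s / (t / m) + 1) * (t / m) := by gcongr
      _ = s + t / m := by rw [add_mul, one_mul, div_mul_cancel₀ _ hd0.ne']
  refine hav i (Nat.ceil_le.2 ?_) ((hr _ hle (hlt.trans hn)).trans hX)
  rw [div_le_iff₀ hd0, ← hm, mul_div_cancel₀ _ hm0.ne']
  exact hs

omit [Fintype V] [DecidableEq V] in
theorem measurableSet_lt_hitTime (v : V) (t : ℝ≥0) :
    MeasurableSet {ω : PathSpace V | (t : ℝ≥0∞) < hitTime v ω} :=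
  measurableSet_of_tendsto_indicator atTop (fun _ => measurableSet_avoidGrid _ _ _)
    (eventually_mem_avoidGrid_iff v t)

omit [Fintype V] [DecidableEq V] in
theorem measurable_hitTime (v : V) : Measurable (hitTime (V := V) v) := by
  refine measurable_of_Ioi fun a => ?_
  induction a using ENNReal.recTopCoe with
  | top => simp
  | coe a => exact measurableSet_lt_hitTime v a

/-- Over a short time `d`, killing at `v` multiplies a left eigenvector by `exp (-l d)`, up to an
error `o(d)`. -/
theorem exists_sum_abs_update_vecMul_sub_le {μ : V → ℝ} {v : V} {l : ℝ} (hμv : μ v = 0)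
    (hμl : ∀ b, b ≠ v → (μ ᵥ* generator q) b = l * μ b) {ε : ℝ} (hε : 0 < ε) :
    ∃ η > 0, ∀ d : ℝ, 0 ≤ d → d < η →
      ∑ b, |Function.update (μ ᵥ* transition q d) v 0 b - Real.exp (-(l * d)) * μ b| ≤ ε * d := by
  have hder : ∀ b, HasDerivAt (fun d => Function.update (μ ᵥ* transition q d) v 0 b
      - Real.exp (-(l * d)) * μ b) 0 0 := by
    intro b
    by_cases hb : b = v
    · subst hb
      simpa [hμv] using hasDerivAt_const (0 : ℝ) (0 : ℝ)
    · have h1 : HasDerivAt (fun d => ∑ x, μ x * transition q d x b)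
          (∑ x, μ x * -generator q x b) 0 :=
        HasDerivAt.fun_sum fun x _ => (hasDerivAt_transition q x b).const_mul (μ x)
      have h2 : HasDerivAt (fun d : ℝ => Real.exp (-(l * d)) * μ b) (-l * μ b) 0 := by
        have := (((hasDerivAt_id (0 : ℝ)).const_mul l).neg.exp).mul_const (μ b)
        simpa using this
      simp only [Function.update_of_ne hb]
      refine (h1.sub h2).congr_deriv ?_
      have := hμl b hb
      simp only [vecMul, dotProduct] at this
      simp only [mul_neg, Finset.sum_neg_distrib, this]
      ring
  have hcard : (0 : ℝ) < Fintype.card V := by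
    exact_mod_cast Fintype.card_pos_iff.2 ⟨v⟩
  obtain ⟨η, hη, H⟩ := exists_uniform_linear_approx hder (div_pos hε hcard)
  refine ⟨η, hη, fun d hd hdη => ?_⟩
  have h0 : ∀ b, Function.update (μ ᵥ* transition q 0) v 0 b - Real.exp (-(l * 0)) * μ b = 0 := by
    intro b
    by_cases hb : b = v
    · subst hb; simp [hμv]
    · simp [Function.update_of_ne hb, transition_zero]
  calc _ ≤ ∑ _b : V, ε / Fintype.card V * d := Finset.sum_le_sum fun b _ => by
        have := H d hd hdη b
        rwa [h0, sub_zero, mul_zero, sub_zero] at this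
    _ = ε * d := by
        rw [Finset.sum_const, Finset.card_univ, nsmul_eq_mul]
        field_simp

/-- Started from a left eigenvector `μ` of the generator killed at `v`, the chain killed at `v` has
mass `exp (-l t) μ` at time `t`. -/
theorem real_lt_hitTime_inter (hP : IsChainLaw q P) {μ : V → ℝ} (hμ : μ ∈ stdSimplex ℝ V) {v : V}
    {l : ℝ} (hl : 0 ≤ l) (hμv : μ v = 0)
    (hμl : ∀ b, b ≠ v → (μ ᵥ* generator q) b = l * μ b) (t : ℝ≥0) (b : V) :
    (lawFrom P μ).real ({ω | (t : ℝ≥0∞) < hitTime v ω} ∩ {ω | X t ω = b})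
      = Real.exp (-(l * t)) * μ b := by
  have := isProbabilityMeasure_lawFrom hP hμ
  have hnt : ∀ n : ℕ, ((n + 1 : ℕ) : ℝ≥0) * (t / (n + 1 : ℕ)) = t := fun n =>
    mul_div_cancel₀ _ (by positivity)
  have hlim1 : Tendsto (fun n : ℕ => gridMass P μ (fun _ => v) (t / (n + 1 : ℕ)) (n + 1) b) atTop
      (nhds ((lawFrom P μ).real ({ω | (t : ℝ≥0∞) < hitTime v ω} ∩ {ω | X t ω = b}))) := by
    simp only [gridMass, hnt]
    refine (ENNReal.tendsto_toReal (by finiteness)).comp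
      (tendsto_measure_of_tendsto_indicator_of_isFiniteMeasure atTop _
        (fun n => (measurableSet_avoidGrid _ _ _).inter (measurableSet_X_eq _ _)) fun ω => ?_)
    filter_upwards [eventually_mem_avoidGrid_iff v t ω] with n hn
    exact and_congr_left fun _ => hn
  -- The one-step errors add up, since each later step contracts the `ℓ¹` norm.
  have hgrid : ∀ (ε η : ℝ), (∀ d : ℝ, 0 ≤ d → d < η →
      ∑ b, |Function.update (μ ᵥ* transition q d) v 0 b - Real.exp (-(l * d)) * μ b| ≤ ε * d) →
      ∀ d : ℝ≥0, (d : ℝ) < η → ∀ k : ℕ,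
      ∑ b, |gridMass P μ (fun _ => v) d k b - Real.exp (-(l * (k * d))) * μ b|
        ≤ k * (ε * d) := by
    intro ε η H d hd k
    induction k with
    | zero =>
      rw [gridMass_zero hP hμ.1, ← hμv, Function.update_eq_self]
      simp
    | succ k ih =>
      set g := gridMass P μ (fun _ => v) d k with hg
      set c := Real.exp (-(l * (k * d))) with hc
      have hc1 : c ≤ 1 := Real.exp_le_one_iff.2 (neg_nonpos.2 (by positivity))
      have hstep : ∀ b, |gridMass P μ (fun _ => v) d (k + 1) b
            - Real.exp (-(l * ((k + 1 : ℕ) * d))) * μ b|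
          ≤ |((g - c • μ) ᵥ* transition q d) b|
            + |Function.update (μ ᵥ* transition q d) v 0 b - Real.exp (-(l * d)) * μ b| := by
        intro b
        have hexp : Real.exp (-(l * ((k + 1 : ℕ) * d))) = c * Real.exp (-(l * d)) := by
          rw [hc, ← Real.exp_add]; congr 1; push_cast; ring
        rw [gridMass_succ hP hμ.1, hexp]
        by_cases hb : b = v
        · subst hb
          simp only [Function.update_self, hμv, mul_zero, sub_zero, abs_zero, add_zero]
          exact abs_nonneg _
        · simp only [Function.update_of_ne hb, sub_vecMul, smul_vecMul, Pi.sub_apply,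
            Pi.smul_apply, smul_eq_mul]
          calc _ = |((g ᵥ* transition q d) b - c * (μ ᵥ* transition q d) b)
                + c * ((μ ᵥ* transition q d) b - Real.exp (-(l * d)) * μ b)| := by
                congr 1; ring
            _ ≤ _ := (abs_add_le _ _).trans (by
                rw [abs_mul c, abs_of_nonneg (Real.exp_nonneg _)]
                gcongr
                exact mul_le_of_le_one_left (abs_nonneg _) hc1)
      refine (Finset.sum_le_sum fun b _ => hstep b).trans ?_
      rw [Finset.sum_add_distrib]
      have h1 := (hP.sum_abs_vecMul_le d (g - c • μ)).trans
        (by simpa only [Pi.sub_apply, Pi.smul_apply, smul_eq_mul] using ih)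
      have h2 := H d d.2 hd
      push_cast
      linarith
  refine tendsto_nhds_unique hlim1 (Metric.tendsto_nhds.2 fun ε hε => ?_)
  have ht1 : (0 : ℝ) < t + 1 := by positivity
  obtain ⟨η, hη, H⟩ := exists_sum_abs_update_vecMul_sub_le hμv hμl (div_pos hε ht1)
  have hd : Tendsto (fun n : ℕ => (t : ℝ) / ((n + 1 : ℕ) : ℝ)) atTop (nhds 0) :=
    (tendsto_const_div_atTop_nhds_zero_nat (t : ℝ)).comp (tendsto_add_atTop_nat 1)
  filter_upwards [hd.eventually_lt_const hη] with n hn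
  have h1 := hgrid _ η H (t / (n + 1 : ℕ)) (by simpa using hn) (n + 1)
  have hnt' : ((n + 1 : ℕ) : ℝ) * ((t / (n + 1 : ℕ) : ℝ≥0) : ℝ) = t := by
    have := congrArg NNReal.toReal (hnt n)
    simpa using this
  rw [hnt', mul_left_comm, hnt'] at h1
  rw [Real.dist_eq]
  calc _ ≤ _ := Finset.single_le_sum (f := fun b =>
        |gridMass P μ (fun _ => v) (t / (n + 1 : ℕ)) (n + 1) b - Real.exp (-(l * t)) * μ b|)
        (fun b _ => abs_nonneg _) (Finset.mem_univ b)
    _ ≤ ε / (t + 1) * t := h1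
    _ < ε := by
        rw [div_mul_eq_mul_div, div_lt_iff₀ ht1]
        nlinarith

section Eigenvector

variable (hP : IsChainLaw q P) {μ : V → ℝ} (hμ : μ ∈ stdSimplex ℝ V) {v : V} {l : ℝ} (hl : 0 < l)
  (hμv : μ v = 0) (hμl : ∀ b, b ≠ v → (μ ᵥ* generator q) b = l * μ b)
include hP hμ hl hμv hμl

theorem real_lt_hitTime (t : ℝ≥0) :
    (lawFrom P μ).real {ω | (t : ℝ≥0∞) < hitTime v ω} = Real.exp (-(l * t)) := by
  have := isProbabilityMeasure_lawFrom hP hμ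
  rw [← sum_real_inter_X_eq _ (measurableSet_lt_hitTime v t) t]
  simp only [real_lt_hitTime_inter hP hμ hl.le hμv hμl]
  rw [← Finset.mul_sum, hμ.2, mul_one]

theorem isQuasistationary_of_eigenvector : IsQuasistationary P v μ := by
  have := isProbabilityMeasure_lawFrom hP hμ
  refine ⟨hμ, fun t => ⟨?_, fun b => ?_⟩⟩
  · refine (ENNReal.toReal_pos_iff.1 (?_ : 0 < (lawFrom P μ).real _)).1
    rw [real_lt_hitTime hP hμ hl hμv hμl]
    exact Real.exp_pos _
  · rw [measureReal_def, ProbabilityTheory.cond_apply (measurableSet_lt_hitTime v t),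
      ENNReal.toReal_mul, ENNReal.toReal_inv, ← measureReal_def, ← measureReal_def,
      real_lt_hitTime hP hμ hl hμv hμl, real_lt_hitTime_inter hP hμ hl.le hμv hμl,
      inv_mul_cancel_left₀ (Real.exp_pos _).ne']

theorem expHitTime_eq : expHitTime P μ v = ENNReal.ofReal l⁻¹ := by
  have := isProbabilityMeasure_lawFrom hP hμ
  have hmeas : ∀ t : ℝ≥0, lawFrom P μ {ω | (t : ℝ≥0∞) < hitTime v ω}
      = ENNReal.ofReal (Real.exp (-(l * t))) := fun t => by
    rw [← real_lt_hitTime hP hμ hl hμv hμl, ofReal_measureReal]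
  have hfin : ∀ᵐ ω ∂lawFrom P μ, hitTime v ω ≠ ⊤ := by
    have h0 : Tendsto (fun n : ℕ => ENNReal.ofReal (Real.exp (-(l * ((n : ℝ≥0) : ℝ))))) atTop
        (nhds 0) := by
      rw [← ENNReal.ofReal_zero]
      refine ENNReal.tendsto_ofReal (Real.tendsto_exp_atBot.comp (tendsto_neg_atTop_atBot.comp
        (Tendsto.const_mul_atTop hl ?_)))
      simpa using tendsto_natCast_atTop_atTop (R := ℝ)
    rw [ae_iff]
    refine le_antisymm (ge_of_tendsto' h0 fun n => ?_) bot_le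
    rw [← hmeas]
    refine measure_mono fun ω hω => ?_
    have hω' : hitTime v ω = ⊤ := not_not.1 hω
    exact (hω' ▸ ENNReal.coe_lt_top : _ < hitTime v ω)
  have h1 : expHitTime P μ v = ∫⁻ ω, ENNReal.ofReal (hitTime v ω).toReal ∂lawFrom P μ :=
    lintegral_congr_ae (hfin.mono fun ω h => (ENNReal.ofReal_toReal h).symm)
  rw [h1, lintegral_eq_lintegral_meas_lt _ (Eventually.of_forall fun _ => ENNReal.toReal_nonneg)
    (measurable_hitTime v).ennreal_toReal.aemeasurable]
  have h2 : ∀ t ∈ Set.Ioi (0 : ℝ), lawFrom P μ {ω | t < (hitTime v ω).toReal}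
      = ENNReal.ofReal (Real.exp (-l * t)) := by
    intro t ht
    have := hmeas ⟨t, le_of_lt ht⟩
    change _ = ENNReal.ofReal (Real.exp (-(l * t))) at this
    rw [← neg_mul] at this
    rw [← this]
    refine measure_congr (hfin.mono fun ω h => propext ?_)
    change t < (hitTime v ω).toReal ↔ _ < hitTime v ω
    rw [← ENNReal.ofReal_lt_iff_lt_toReal (le_of_lt ht) h, ENNReal.ofReal,
      Real.toNNReal_of_nonneg (le_of_lt ht)]
    rfl
  rw [setLIntegral_congr_fun measurableSet_Ioi h2, ← ofReal_integral_eq_lintegral_ofReal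
    (exp_neg_integrableOn_Ioi 0 hl)
    (Eventually.of_forall fun _ => Real.exp_nonneg _), integral_exp_mul_Ioi (neg_lt_zero.2 hl)]
  simp

end Eigenvector

end MeetingTime

theorem mainTheorem3 {V : Type*} [Fintype V] [DecidableEq V] [Nontrivial V]
    (q : V → V → ℝ) (hq : ∀ x y, x ≠ y → 0 ≤ q x y)
    (hirr : MeetingTime.IsIrreducible q)
    (P : V → MeasureTheory.Measure (MeetingTime.PathSpace V))
    (hP : MeetingTime.IsChainLaw q P)
    (π : V → ℝ) (hstat : MeetingTime.IsStationary P π) (hrev : MeetingTime.IsReversible q π) :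
    ∃ (v : V) (qv : V → ℝ), MeetingTime.IsQuasistationary P v qv ∧
      0 < MeetingTime.expHitTime P qv v ∧ MeetingTime.expHitTime P qv v < ⊤ ∧
      ∀ (h : MeetingTime.PathSpace V) (t : ℝ≥0),
        (MeetingTime.lawFrom P π).real
            {ω | ∀ s : ℝ≥0, s ≤ t → MeetingTime.X s ω ≠ MeetingTime.X s h}
          ≤ (MeetingTime.lawFrom P qv).real
              {ω | (t : ℝ≥0∞) < MeetingTime.hitTime v ω} ∧
        (MeetingTime.lawFrom P qv).real {ω | (t : ℝ≥0∞) < MeetingTime.hitTime v ω}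
          = Real.exp (-(t : ℝ) / (MeetingTime.expHitTime P qv v).toReal) := by
  have hπ := MeetingTime.IsReversible.pos hirr hrev hstat.1
  choose l f hl hf0 hfv hfn hfl hmin using
    MeetingTime.exists_dirichlet_eigenfunction hq hπ hrev hirr
  -- The state `v` that is hardest to hit has the smallest principal Dirichlet eigenvalue.
  obtain ⟨v, hv⟩ := Finite.exists_min l
  set Z := ∑ x, π x * f v x with hZ
  have hsummand : ∀ x, 0 ≤ π x * f v x := fun x => mul_nonneg (hπ x).le (hf0 v x)
  have hZpos : 0 < Z := by
    refine (Finset.sum_nonneg fun x _ => hsummand x).lt_of_ne fun h0 => ?_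
    have hz : ∀ x, f v x = 0 := fun x => (mul_eq_zero.1
      ((Finset.sum_eq_zero_iff_of_nonneg fun x _ => hsummand x).1 h0.symm x
        (Finset.mem_univ x))).resolve_left (hπ x).ne'
    have := hfn v
    simp [hz] at this
  set μ : V → ℝ := fun x => π x * (Z⁻¹ • f v) x with hμdef
  have hμ : μ ∈ stdSimplex ℝ V := by
    refine ⟨fun x => mul_nonneg (hπ x).le (mul_nonneg (inv_nonneg.2 hZpos.le) (hf0 v x)), ?_⟩
    simp only [hμdef, Pi.smul_apply, smul_eq_mul, mul_left_comm _ Z⁻¹, ← Finset.mul_sum]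
    exact inv_mul_cancel₀ hZpos.ne'
  have hμv : μ v = 0 := by simp [hμdef, hfv]
  have hμl : ∀ b, b ≠ v → Matrix.vecMul μ (MeetingTime.generator q) b = l v * μ b := by
    intro b hb
    rw [hμdef, MeetingTime.vecMul_generator hrev, Matrix.mulVec_smul]
    simp only [Pi.smul_apply, smul_eq_mul, hfl v b hb]
    ring
  have hexp := MeetingTime.expHitTime_eq hP hμ (hl v) hμv hμl
  refine ⟨v, μ, MeetingTime.isQuasistationary_of_eigenvector hP hμ (hl v) hμv hμl, ?_, ?_,
    fun h t => ?_⟩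
  · rw [hexp]; exact ENNReal.ofReal_pos.2 (inv_pos.2 (hl v))
  · rw [hexp]; exact ENNReal.ofReal_lt_top
  rw [MeetingTime.real_lt_hitTime hP hμ (hl v) hμv hμl, hexp,
    ENNReal.toReal_ofReal (inv_nonneg.2 (hl v).le)]
  refine ⟨MeetingTime.real_avoid_le hP hπ hstat.1.2 hrev (fun w g hg => ?_) h.toFun t, ?_⟩
  · refine (mul_le_mul_of_nonneg_right (hv w) ?_).trans (hmin w g hg)
    exact Finset.sum_nonneg fun x _ => mul_nonneg (hπ x).le (sq_nonneg _)
  · congr 1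
    rw [div_inv_eq_mul]; ring
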